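/- All graphs are finite, simple and undirected. A \(k\)-colouring of a graph \(G\) is a map \(f\colon V(G)\to\{0,1,\dots,k-1\}\) with \(f(u)\neq f(v)\) for every edge \(uv\) of \(G\). A bicoloured component of \((G,f)\) is a connected component of the subgraph of \(G\) induced by the union of two distinct colour classes \(f^{-1}(i)\cup f^{-1}(j)\), \(i\neq j\). The colouring \(f\) is a \(k\)-star colouring if every bicoloured component is a star \(K_{1,q}\) with \(q\geq 0\), and it is a distance-two \(k\)-colouring if every bicoloured component is \(K_1\) or \(K_2\). A graph is \(k\)-star colourable (respectively, distance-two \(k\)-colourable) if it admits a \(k\)-star colouring (respectively, a distance-two \(k\)-colouring). The line graph \(L(G)\) has vertex set \(E(G)\), and two distinct edges of \(G\) are adjacent in \(L(G)\) if they share an endpoint. **Theorem.** For every 3-regular graph \(G\), the line graph \(L(G)\) is 4-star colourable if and only if \(G\) is bipartite and distance-two 4-colourable. -/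

import Mathlib

/-- The subgraph of `G` induced by the colour classes of `i` and `j` under the colouring `f`. -/
def bicolouredSubgraph {V : Type*} {G : SimpleGraph V} {k : ℕ} (f : G.Coloring (Fin k))
    (i j : Fin k) : SimpleGraph {v : V | f v = i ∨ f v = j} :=
  G.induce {v : V | f v = i ∨ f v = j}

/-- A `k`-colouring is a `k`-star colouring if every bicoloured component is a star `K_{1,q}`,
where `q ≥ 0`. -/
def IsStarColouring {V : Type*} {G : SimpleGraph V} {k : ℕ} (f : G.Coloring (Fin k)) : Prop :=
  ∀ i j : Fin k, i ≠ j → ∀ C : (bicolouredSubgraph f i j).ConnectedComponent,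
    ∃ q : ℕ, Nonempty (C.toSimpleGraph ≃g completeBipartiteGraph (Fin 1) (Fin q))

/-- A `k`-colouring is a distance-two `k`-colouring if every bicoloured component is
`K_1` or `K_2`. -/
def IsDistanceTwoColouring {V : Type*} {G : SimpleGraph V} {k : ℕ}
    (f : G.Coloring (Fin k)) : Prop :=
  ∀ i j : Fin k, i ≠ j → ∀ C : (bicolouredSubgraph f i j).ConnectedComponent,
    Nonempty (C.toSimpleGraph ≃g (⊤ : SimpleGraph (Fin 1))) ∨
      Nonempty (C.toSimpleGraph ≃g (⊤ : SimpleGraph (Fin 2)))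

/-- `G` is `k`-star colourable. -/
def StarColourable {V : Type*} (G : SimpleGraph V) (k : ℕ) : Prop :=
  ∃ f : G.Coloring (Fin k), IsStarColouring f

/-- `G` is distance-two `k`-colourable. -/
def DistanceTwoColourable {V : Type*} (G : SimpleGraph V) (k : ℕ) : Prop :=
  ∃ f : G.Coloring (Fin k), IsDistanceTwoColouring f

/-!
A star colouring of the line graph is a proper edge colouring of `G` without a two-coloured path
or cycle of four edges. With four colours and a cubic graph, exactly one colour `c v` is missing
at each vertex `v`. If two vertices at distance at most two missed the same colour, a two-coloured
path could be traced through them, so `c` is a distance-two colouring.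

The three edges at `u` carry the three colours other than `c u`, and so do the three neighbours of
`u` under `c`. The edge `uv` avoids `c v`, so neighbours and edges are matched by a derangement of
three colours. There are only two such derangements, given by the row and by the column of `c u`
in the idempotent Latin square of order four. Across an edge `uv` the entries at `(c u, c v)` and
`(c v, c u)` differ, so a vertex following its row has only neighbours following their columns,
and conversely: this is the bipartition.

In the other direction, a bipartition and a distance-two colouring `c` give the edge colouring
read off the Latin square. The two colours of a two-coloured path `z x u v y` would both avoid the
distinct colours `c x`, `c u`, `c v`, which is impossible with four colours.
-/

section StarForest

variable {W : Type*} {H : SimpleGraph W}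

theorem isUniversal_of_connected (hH : H.Connected) {v : W}
    (hv : ∀ x y, H.Adj v x → H.Adj x y → y = v) : H.IsUniversal v := by
  intro w hvw
  suffices w = v ∨ H.Adj v w from this.resolve_left hvw.symm
  clear hvw
  induction (H.reachable_iff_reflTransGen v w).1 (hH.preconnected v w) with
  | refl => exact Or.inl rfl
  | tail _ hxy hx =>
    rcases hx with rfl | hvx
    · exact Or.inr hxy
    · exact Or.inl (hv _ _ hvx hxy)

theorem finite_of_isUniversal {v : W} (hv : H.IsUniversal v) (hfin : (H.neighborSet v).Finite) :
    Finite W :=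
  Set.finite_univ_iff.1 (SimpleGraph.insert_neighborSet_eq_univ.2 hv ▸ hfin.insert v)

/-- The star forests, encoded by the absence of paths and cycles with three edges. Triangles are
excluded as well, since `d = a` is allowed. For locally finite graphs this says that every component
is a star `K_{1,q}`; see `isStarForest_iff_forall_component`. -/
def IsStarForest (H : SimpleGraph W) : Prop :=
  ∀ ⦃a b c d⦄, H.Adj a b → H.Adj b c → H.Adj c d → a ≠ c → b = d

namespace IsStarForest

theorem of_injective_hom {W' : Type*} {H' : SimpleGraph W'} (h : IsStarForest H')
    (φ : H →g H') (hφ : Function.Injective φ) : IsStarForest H :=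
  fun _ _ _ _ hab hbc hcd hac ↦
    hφ (h (φ.map_adj hab) (φ.map_adj hbc) (φ.map_adj hcd) (hφ.ne hac))

theorem not_adj_of_adj_of_adj (h : IsStarForest H) {a b c : W} (hab : H.Adj a b)
    (hbc : H.Adj b c) : ¬ H.Adj a c :=
  fun hac ↦ hab.ne' (h hab hbc hac.symm hac.ne)

theorem exists_isUniversal (h : IsStarForest H) (hH : H.Connected) : ∃ v, H.IsUniversal v := by
  by_cases hpath : ∃ a v b, H.Adj a v ∧ H.Adj v b ∧ a ≠ b
  · obtain ⟨a, v, b, hav, hvb, hab⟩ := hpath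
    refine ⟨v, isUniversal_of_connected hH fun x y hvx hxy ↦ ?_⟩
    by_cases hax : a = x
    · exact (h hvb.symm hvx hxy (hax ▸ hab.symm)).symm
    · exact (h hav hvx hxy hax).symm
  · push Not at hpath
    obtain ⟨v⟩ := hH.nonempty
    exact ⟨v, isUniversal_of_connected hH fun x y hvx hxy ↦ (hpath v x y hvx hxy).symm⟩

theorem exists_eq_starGraph (h : IsStarForest H) (hH : H.Connected) :
    ∃ v, H = SimpleGraph.starGraph v := by
  obtain ⟨v, hv⟩ := h.exists_isUniversal hH
  refine ⟨v, ?_⟩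
  ext x y
  rw [SimpleGraph.starGraph_adj]
  refine ⟨fun hxy ↦ ⟨hxy.ne, ?_⟩, ?_⟩
  · by_contra! hne
    exact h.not_adj_of_adj_of_adj (hv hne.1.symm).symm (hv hne.2.symm) hxy
  · rintro ⟨hxy, rfl | rfl⟩
    · exact hv hxy
    · exact (hv hxy.symm).symm

end IsStarForest

theorem exists_starGraph_iso_completeBipartiteGraph [Finite W] (v : W) :
    ∃ q : ℕ, Nonempty (SimpleGraph.starGraph v ≃g completeBipartiteGraph (Fin 1) (Fin q)) := by
  classical
  obtain ⟨q, ⟨e⟩⟩ := Finite.exists_equiv_fin {w : W // ¬ w = v}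
  let φ : Fin 1 ⊕ Fin q ≃ W :=
    ((Equiv.ofUnique (Fin 1) {w : W // w = v}).sumCongr e.symm).trans (Equiv.sumCompl (· = v))
  have hinl (a : Fin 1) : φ (Sum.inl a) = v := (Equiv.ofUnique (Fin 1) {w : W // w = v} a).2
  have hinr (b : Fin q) : φ (Sum.inr b) ≠ v := (e.symm b).2
  refine ⟨q, ⟨SimpleGraph.Iso.symm ⟨φ, ?_⟩⟩⟩
  rintro (a | a) (b | b) <;> simp [hinl, hinr, (hinr _).symm]

theorem isStarForest_completeBipartiteGraph_fin_one (β : Type*) :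
    IsStarForest (completeBipartiteGraph (Fin 1) β) := by
  rintro (a | a) (b | b) (c | c) (d | d) <;> simp [eq_iff_true_of_subsingleton]

theorem isStarForest_iff_exists_iso (hH : H.Connected) (hfin : ∀ v, (H.neighborSet v).Finite) :
    IsStarForest H ↔ ∃ q : ℕ, Nonempty (H ≃g completeBipartiteGraph (Fin 1) (Fin q)) := by
  constructor
  · intro h
    obtain ⟨v, hv⟩ := h.exists_isUniversal hH
    have : Finite W := finite_of_isUniversal hv (hfin v)
    obtain ⟨v, rfl⟩ := h.exists_eq_starGraph hH
    exact exists_starGraph_iso_completeBipartiteGraph v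
  · rintro ⟨q, ⟨φ⟩⟩
    exact (isStarForest_completeBipartiteGraph_fin_one _).of_injective_hom φ.toHom φ.injective

theorem isStarForest_iff_forall_toSimpleGraph :
    IsStarForest H ↔ ∀ C : H.ConnectedComponent, IsStarForest C.toSimpleGraph := by
  refine ⟨fun h C ↦ h.of_injective_hom C.toSimpleGraph_hom Subtype.val_injective, ?_⟩
  intro h a b c d hab hbc hcd hac
  let C := H.connectedComponentMk a
  have hb : b ∈ C.supp := C.mem_supp_of_adj_mem_supp rfl hab
  have hc : c ∈ C.supp := C.mem_supp_of_adj_mem_supp hb hbc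
  have hd : d ∈ C.supp := C.mem_supp_of_adj_mem_supp hc hcd
  exact congrArg Subtype.val <|
    @h C ⟨a, rfl⟩ ⟨b, hb⟩ ⟨c, hc⟩ ⟨d, hd⟩ hab hbc hcd (hac <| congrArg Subtype.val ·)

theorem isStarForest_iff_forall_component (hfin : ∀ v, (H.neighborSet v).Finite) :
    IsStarForest H ↔ ∀ C : H.ConnectedComponent,
      ∃ q : ℕ, Nonempty (C.toSimpleGraph ≃g completeBipartiteGraph (Fin 1) (Fin q)) := by
  rw [isStarForest_iff_forall_toSimpleGraph]
  exact forall_congr' fun C ↦ isStarForest_iff_exists_iso C.connected_toSimpleGraph fun v ↦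
    (hfin v).preimage Subtype.val_injective.injOn

end StarForest

section Matching

variable {W : Type*} {H : SimpleGraph W}

theorem subsingleton_neighborSet_iff_nonempty_iso (hH : H.Connected) :
    (∀ v, (H.neighborSet v).Subsingleton) ↔
      Nonempty (H ≃g (⊤ : SimpleGraph (Fin 1))) ∨ Nonempty (H ≃g (⊤ : SimpleGraph (Fin 2))) := by
  constructor
  · intro h
    have huniv (v : W) : H.IsUniversal v :=
      isUniversal_of_connected hH fun x y hvx hxy ↦ h x hxy hvx.symm
    obtain rfl : H = ⊤ := SimpleGraph.eq_top_iff_forall_isUniversal.2 huniv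
    obtain ⟨v⟩ := hH.nonempty
    have : Finite W := finite_of_isUniversal (huniv v) (h v).finite
    have hv : ({v}ᶜ : Set W).Subsingleton := (huniv v).neighborSet_eq ▸ h v
    have hcard : Nat.card W = 1 ∨ Nat.card W = 2 := by
      have hle := Set.ncard_le_one_iff_subsingleton.2 hv
      have hadd := Set.ncard_add_ncard_compl ({v} : Set W)
      rw [Set.ncard_singleton] at hadd
      omega
    refine hcard.imp (fun hone ↦ ?_) (fun htwo ↦ ?_)
    · exact ⟨.completeGraph (Finite.equivFinOfCardEq hone)⟩
    · exact ⟨.completeGraph (Finite.equivFinOfCardEq htwo)⟩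
  · rintro (⟨⟨φ⟩⟩ | ⟨⟨φ⟩⟩) v x hx y hy
    · exact φ.injective (Subsingleton.elim _ _)
    · have hvx : φ v ≠ φ x := φ.injective.ne hx.ne
      have hvy : φ v ≠ φ y := φ.injective.ne hy.ne
      exact φ.injective (by omega)

theorem subsingleton_neighborSet_iff_forall_toSimpleGraph :
    (∀ v, (H.neighborSet v).Subsingleton) ↔
      ∀ (C : H.ConnectedComponent) v, (C.toSimpleGraph.neighborSet v).Subsingleton := by
  refine ⟨fun h C v x hx y hy ↦ Subtype.ext (h v hx hy), fun h v x hx y hy ↦ ?_⟩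
  let C := H.connectedComponentMk v
  have hxC : x ∈ C.supp := C.mem_supp_of_adj_mem_supp rfl hx
  have hyC : y ∈ C.supp := C.mem_supp_of_adj_mem_supp rfl hy
  exact congrArg Subtype.val (@h C ⟨v, rfl⟩ ⟨x, hxC⟩ hx ⟨y, hyC⟩ hy)

theorem subsingleton_neighborSet_iff_forall_component :
    (∀ v, (H.neighborSet v).Subsingleton) ↔ ∀ C : H.ConnectedComponent,
      Nonempty (C.toSimpleGraph ≃g (⊤ : SimpleGraph (Fin 1))) ∨
        Nonempty (C.toSimpleGraph ≃g (⊤ : SimpleGraph (Fin 2))) := by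
  rw [subsingleton_neighborSet_iff_forall_toSimpleGraph]
  exact forall_congr' fun C ↦ subsingleton_neighborSet_iff_nonempty_iso C.connected_toSimpleGraph

end Matching

section Colouring

variable {V : Type*} {G : SimpleGraph V} {k : ℕ}

theorem isStarColouring_iff (hfin : ∀ v, (G.neighborSet v).Finite) (f : G.Coloring (Fin k)) :
    IsStarColouring f ↔ ∀ ⦃a b c d⦄, G.Adj a b → G.Adj b c → G.Adj c d → a ≠ c → b ≠ d →
      f a = f c → f b ≠ f d := by
  have hbifin (i j : Fin k) (v) : ((bicolouredSubgraph f i j).neighborSet v).Finite :=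
    (hfin v).preimage Subtype.val_injective.injOn
  have hforest : IsStarColouring f ↔ ∀ i j, i ≠ j → IsStarForest (bicolouredSubgraph f i j) :=
    forall₃_congr fun i j _ ↦ (isStarForest_iff_forall_component (hbifin i j)).symm
  rw [hforest]
  constructor
  · intro h a b c d hab hbc hcd hac hbd hfac hfbd
    exact hbd <| congrArg Subtype.val <| @h (f a) (f b) (f.valid hab) ⟨a, Or.inl rfl⟩
      ⟨b, Or.inr rfl⟩ ⟨c, Or.inl hfac.symm⟩ ⟨d, Or.inr hfbd.symm⟩ hab hbc hcd
      (hac <| congrArg Subtype.val ·)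
  · rintro h i j - ⟨a, ha⟩ ⟨b, hb⟩ ⟨c, hc⟩ ⟨d, hd⟩ (hab : G.Adj a b) (hbc : G.Adj b c)
      (hcd : G.Adj c d) hac
    have hfab := f.valid hab
    have hfbc := f.valid hbc
    have hfcd := f.valid hcd
    by_contra hbd
    refine h hab hbc hcd (hac <| Subtype.ext ·) (hbd <| Subtype.ext ·) ?_ ?_ <;> grind

theorem isDistanceTwoColouring_iff (f : G.Coloring (Fin k)) :
    IsDistanceTwoColouring f ↔ ∀ v, Set.InjOn f (G.neighborSet v) := by
  have hmatching : IsDistanceTwoColouring f ↔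
      ∀ i j, i ≠ j → ∀ v, ((bicolouredSubgraph f i j).neighborSet v).Subsingleton :=
    forall₃_congr fun i j _ ↦ subsingleton_neighborSet_iff_forall_component.symm
  rw [hmatching]
  constructor
  · intro h v x hx y hy hxy
    exact congrArg Subtype.val <| @h (f v) (f x) (f.valid hx) ⟨v, Or.inl rfl⟩ ⟨x, Or.inr rfl⟩ hx
      ⟨y, Or.inr hxy.symm⟩ hy
  · rintro h i j - ⟨v, hv⟩ ⟨x, hx⟩ (hvx : G.Adj v x) ⟨y, hy⟩ (hvy : G.Adj v y)
    have hfvx := f.valid hvx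
    have hfvy := f.valid hvy
    exact Subtype.ext (h v hvx hvy (by grind))

end Colouring

section EdgeColouring

variable {V α : Type*} {G : SimpleGraph V}

/-- Proper edge colourings, as edge labellings that are injective on the edges at each vertex. -/
def IsProperEdgeColouring (C : G.EdgeLabeling α) : Prop :=
  ∀ v, Function.Injective fun w : G.neighborSet v ↦ C.get v w w.2

/-- Star edge colourings: the proper edge colourings without a two-coloured path or cycle
`z x u v y` of four edges, that is, the star colourings of the line graph. -/
structure IsStarEdgeColouring (C : G.EdgeLabeling α) : Prop where
  proper : IsProperEdgeColouring C
  -- Properness turns `x ≠ v` into `z ≠ u` and `u ≠ y`.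
  not_alternating : ∀ ⦃z x u v y⦄ (hzx : G.Adj z x) (hxu : G.Adj x u) (huv : G.Adj u v)
    (hvy : G.Adj v y), x ≠ v → C.get z x hzx = C.get u v huv → C.get x u hxu ≠ C.get v y hvy

theorem IsProperEdgeColouring.eq_of_get_eq {C : G.EdgeLabeling α} (hC : IsProperEdgeColouring C)
    {v x y : V} (hx : G.Adj v x) (hy : G.Adj v y) (h : C.get v x hx = C.get v y hy) : x = y :=
  congrArg Subtype.val (@hC v ⟨x, hx⟩ ⟨y, hy⟩ h)

end EdgeColouring

section LineGraph

variable {V α : Type*} {G : SimpleGraph V} {C : G.EdgeLabeling α}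

theorem lineGraph_adj_mk_mk {u v w : V} (huv : s(u, v) ∈ G.edgeSet) (hvw : s(v, w) ∈ G.edgeSet) :
    G.lineGraph.Adj ⟨s(u, v), huv⟩ ⟨s(v, w), hvw⟩ ↔ u ≠ w := by
  have heq : s(u, v) = s(v, w) ↔ u = w := by rw [Sym2.eq_swap, Sym2.congr_right]
  rw [SimpleGraph.lineGraph_adj_iff_exists, Ne, Subtype.mk.injEq, heq]
  exact and_iff_left ⟨v, Sym2.mem_mk_right u v, Sym2.mem_mk_left v w⟩

theorem finite_neighborSet_lineGraph (hfin : ∀ v, (G.neighborSet v).Finite) (e : G.edgeSet) :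
    (G.lineGraph.neighborSet e).Finite := by
  classical
  obtain ⟨⟨u, v⟩, he⟩ := e
  have hinc (w : V) : (G.incidenceSet w).Finite :=
    @Finite.of_equiv _ _ (hfin w) (G.incidenceSetEquivNeighborSet w).symm
  refine (((hinc u).union (hinc v)).preimage Subtype.val_injective.injOn).subset ?_
  rintro ⟨e', he'⟩ hadj
  obtain ⟨-, w, hw, hwe'⟩ := SimpleGraph.lineGraph_adj_iff_exists.1 hadj
  rcases Sym2.mem_iff.1 hw with rfl | rfl
  · exact Or.inl ⟨he', hwe'⟩
  · exact Or.inr ⟨he', hwe'⟩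

theorem isProperEdgeColouring_iff :
    IsProperEdgeColouring C ↔ ∀ ⦃e e'⦄, G.lineGraph.Adj e e' → C e ≠ C e' := by
  constructor
  · rintro hC ⟨e, he⟩ ⟨e', he'⟩ hadj hcol
    obtain ⟨hne, v, ⟨x, rfl : e = s(v, x)⟩, ⟨y, rfl : e' = s(v, y)⟩⟩ :=
      SimpleGraph.lineGraph_adj_iff_exists.1 hadj
    exact hne <| Subtype.ext <| Sym2.congr_right.2 <| hC.eq_of_get_eq he he' hcol
  · rintro h v ⟨x, hx⟩ ⟨y, hy⟩ (hxy : C.get v x hx = C.get v y hy)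
    by_contra hne
    refine h ((lineGraph_adj_mk_mk hx.symm hy).2 (hne <| Subtype.ext ·)) ?_
    exact (C.get_comm v x hx.symm).trans hxy

theorem IsStarEdgeColouring.ne_of_lineGraph_adj (hC : IsStarEdgeColouring C) ⦃e₁ e₂ e₃ e₄⦄
    (h₁₂ : G.lineGraph.Adj e₁ e₂) (h₂₃ : G.lineGraph.Adj e₂ e₃) (h₃₄ : G.lineGraph.Adj e₃ e₄)
    (h₁₃ : e₁ ≠ e₃) (h₂₄ : e₂ ≠ e₄) (hcol₁₃ : C e₁ = C e₃) : C e₂ ≠ C e₄ := by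
  intro hcol₂₄
  have hproper := isProperEdgeColouring_iff.1 hC.proper
  obtain ⟨-, x, hx₁, hx₂⟩ := SimpleGraph.lineGraph_adj_iff_exists.1 h₁₂
  obtain ⟨hne, u, hu₂, hu₃⟩ := SimpleGraph.lineGraph_adj_iff_exists.1 h₂₃
  obtain ⟨-, v, hv₃, hv₄⟩ := SimpleGraph.lineGraph_adj_iff_exists.1 h₃₄
  have hxu : x ≠ u := by
    rintro rfl
    exact hproper (SimpleGraph.lineGraph_adj_iff_exists.2 ⟨h₁₃, x, hx₁, hu₃⟩) hcol₁₃
  have huv : u ≠ v := by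
    rintro rfl
    exact hproper (SimpleGraph.lineGraph_adj_iff_exists.2 ⟨h₂₄, u, hu₂, hv₄⟩) hcol₂₄
  obtain ⟨e₁, he₁⟩ := e₁
  obtain ⟨e₂, he₂⟩ := e₂
  obtain ⟨e₃, he₃⟩ := e₃
  obtain ⟨e₄, he₄⟩ := e₄
  obtain ⟨z, rfl : e₁ = s(x, z)⟩ := hx₁
  obtain ⟨y, rfl : e₄ = s(v, y)⟩ := hv₄
  obtain rfl : e₂ = s(x, u) := (Sym2.mem_and_mem_iff hxu).1 ⟨hx₂, hu₂⟩
  obtain rfl : e₃ = s(u, v) := (Sym2.mem_and_mem_iff huv).1 ⟨hu₃, hv₃⟩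
  have hxv : x ≠ v := (lineGraph_adj_mk_mk he₂ he₃).1 h₂₃
  exact hC.not_alternating (SimpleGraph.Adj.symm he₁) he₂ he₃ he₄ hxv
    ((C.get_comm x z _).trans hcol₁₃) hcol₂₄

theorem IsProperEdgeColouring.isStarEdgeColouring (hC : IsProperEdgeColouring C)
    (h : ∀ ⦃e₁ e₂ e₃ e₄⦄, G.lineGraph.Adj e₁ e₂ → G.lineGraph.Adj e₂ e₃ → G.lineGraph.Adj e₃ e₄ →
      e₁ ≠ e₃ → e₂ ≠ e₄ → C e₁ = C e₃ → C e₂ ≠ C e₄) : IsStarEdgeColouring C := by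
  refine ⟨hC, fun z x u v y hzx hxu huv hvy hxv hcol hcol' ↦ ?_⟩
  have hzu : z ≠ u := by
    rintro rfl
    exact hxv (hC.eq_of_get_eq hzx huv hcol)
  have huy : u ≠ y := by
    rintro rfl
    exact hxv (hC.eq_of_get_eq hxu.symm huv (by rw [C.get_comm, hcol', C.get_comm]))
  have hne : s(z, x) ≠ s(u, v) :=
    (ne_of_mem_of_not_mem' (Sym2.mem_mk_left u v) (by simp [hzu.symm, hxu.ne'])).symm
  have hne' : s(x, u) ≠ s(v, y) :=
    ne_of_mem_of_not_mem' (Sym2.mem_mk_right x u) (by simp [huv.ne, huy])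
  exact h ((lineGraph_adj_mk_mk hzx hxu).2 hzu) ((lineGraph_adj_mk_mk hxu huv).2 hxv)
    ((lineGraph_adj_mk_mk huv hvy).2 huy) (hne <| congrArg Subtype.val ·)
    (hne' <| congrArg Subtype.val ·) hcol hcol'

theorem starColourable_lineGraph_iff (hfin : ∀ v, (G.neighborSet v).Finite) {k : ℕ} :
    StarColourable G.lineGraph k ↔ ∃ C : G.EdgeLabeling (Fin k), IsStarEdgeColouring C := by
  constructor
  · rintro ⟨f, hf⟩
    have hproper : IsProperEdgeColouring (G := G) fun e ↦ f e :=
      isProperEdgeColouring_iff.2 fun _ _ ↦ f.valid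
    rw [isStarColouring_iff (finite_neighborSet_lineGraph hfin)] at hf
    exact ⟨_, hproper.isStarEdgeColouring hf⟩
  · rintro ⟨C, hC⟩
    let f : G.lineGraph.Coloring (Fin k) := .mk C (isProperEdgeColouring_iff.1 hC.proper ·)
    refine ⟨f, (isStarColouring_iff (finite_neighborSet_lineGraph hfin) f).2 ?_⟩
    exact hC.ne_of_lineGraph_adj

end LineGraph

section MissingColour

variable {V α : Type*} {G : SimpleGraph V} {C : G.EdgeLabeling α} {c : V → α}

/-- `c v` is the only colour that does not occur on the edges at `v`, for every vertex `v`. This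
vertex colouring is the distance-two colouring obtained from a star edge colouring. -/
def IsMissingColour (C : G.EdgeLabeling α) (c : V → α) : Prop :=
  ∀ v k, k ≠ c v ↔ ∃ w, ∃ h : G.Adj v w, C.get v w h = k

theorem exists_isMissingColour [Fintype α] [G.LocallyFinite] {d : ℕ}
    (hG : G.IsRegularOfDegree d) (hcard : Fintype.card α = d + 1) (hC : IsProperEdgeColouring C) :
    ∃ c, IsMissingColour C c := by
  classical
  have hmissing (v : V) : ∃ m, ∀ k, k ≠ m ↔ ∃ w, ∃ h : G.Adj v w, C.get v w h = k := by
    let colours : Finset α := Finset.univ.image fun w : G.neighborSet v ↦ C.get v w w.2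
    have hcolours : colours.card = d := by
      rw [Finset.card_image_of_injective _ (hC v), Finset.card_univ, G.card_neighborSet_eq_degree,
        hG v]
    have hcompl : coloursᶜ.card = 1 := by
      rw [Finset.card_compl, hcolours, hcard, Nat.add_sub_cancel_left]
    obtain ⟨m, hm⟩ := Finset.card_eq_one.1 hcompl
    refine ⟨m, fun k ↦ ?_⟩
    rw [Ne, ← Finset.mem_singleton, ← hm, Finset.mem_compl, not_not]
    simp [colours]
  choose c hc using hmissing
  exact ⟨c, hc⟩

namespace IsMissingColour

theorem get_ne_left (hc : IsMissingColour C c) {u v : V} (huv : G.Adj u v) :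
    C.get u v huv ≠ c u :=
  (hc u _).2 ⟨v, huv, rfl⟩

theorem get_ne_right (hc : IsMissingColour C c) {u v : V} (huv : G.Adj u v) :
    C.get u v huv ≠ c v := by
  rw [C.get_comm]
  exact hc.get_ne_left huv.symm

theorem eq_get_of_eq (hc : IsMissingColour C c) (hC : IsStarEdgeColouring C) {u v x : V}
    (huv : G.Adj u v) (hux : G.Adj u x) (hxv : x ≠ v) (hcuv : c u = c v) :
    c x = C.get u v huv := by
  by_contra hne
  obtain ⟨z, hxz, hz⟩ := (hc x _).1 (Ne.symm hne)
  obtain ⟨y, hvy, hy⟩ := (hc v _).1 (hcuv ▸ hc.get_ne_left hux)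
  exact hC.not_alternating hxz.symm hux.symm huv hvy hxv ((C.get_comm _ _ _).trans hz)
    ((C.get_comm _ _ _).trans hy.symm)

theorem ne_of_adj [Fintype α] (hc : IsMissingColour C c) (hC : IsStarEdgeColouring C)
    (hcard : 4 ≤ Fintype.card α) {u v : V} (huv : G.Adj u v) : c u ≠ c v := by
  classical
  intro hcuv
  have hpair : ({c u, C.get u v huv}ᶜ : Finset α).Nontrivial := by
    rw [← Finset.one_lt_card_iff_nontrivial, Finset.card_compl]
    have := Finset.card_le_two (a := c u) (b := C.get u v huv)
    omega
  obtain ⟨a, ha, b, hb, hab⟩ := hpair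
  simp only [Finset.coe_compl, Finset.coe_insert, Finset.coe_singleton, Set.mem_compl_iff,
    Set.mem_insert_iff, Set.mem_singleton_iff, not_or] at ha hb
  obtain ⟨x, hux, rfl⟩ := (hc u a).1 ha.1
  obtain ⟨y, huy, rfl⟩ := (hc u b).1 hb.1
  have hxv : x ≠ v := by rintro rfl; exact ha.2 rfl
  have hyv : y ≠ v := by rintro rfl; exact hb.2 rfl
  have hxy : x ≠ y := by rintro rfl; exact hab rfl
  have hcx : c x = C.get u v huv := hc.eq_get_of_eq hC huv hux hxv hcuv
  have hcy : c y = C.get u v huv := hc.eq_get_of_eq hC huv huy hyv hcuv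
  obtain ⟨z, hxz, hz⟩ := (hc x _).1 (hcx ▸ hb.2)
  obtain ⟨w, hyw, hw⟩ := (hc y _).1 (hcy ▸ ha.2)
  exact hC.not_alternating hxz.symm hux.symm huy hyw hxy ((C.get_comm _ _ _).trans hz)
    ((C.get_comm _ _ _).trans hw.symm)

theorem injOn_neighborSet (hc : IsMissingColour C c) (hC : IsStarEdgeColouring C) (v : V) :
    Set.InjOn c (G.neighborSet v) := by
  intro u (hvu : G.Adj v u) w (hvw : G.Adj v w) hcuw
  by_contra huw
  obtain ⟨z, huz, hz⟩ := (hc u _).1 (hcuw ▸ hc.get_ne_right hvw)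
  obtain ⟨y, hwy, hy⟩ := (hc w _).1 (hcuw ▸ hc.get_ne_right hvu)
  exact hC.not_alternating huz.symm hvu.symm hvw hwy huw ((C.get_comm _ _ _).trans hz)
    ((C.get_comm _ _ _).trans hy.symm)

end IsMissingColour

end MissingColour

section LatinSquare

/-- The idempotent Latin square of order four. For `j ≠ i`, the entries `j ↦ latinSquare i j` of the
row of `i` and the entries `j ↦ latinSquare j i` of its column are the two derangements of the
complement of `i`. -/
def latinSquare : Fin 4 → Fin 4 → Fin 4 :=
  ![![0, 3, 1, 2], ![2, 1, 3, 0], ![3, 0, 2, 1], ![1, 2, 0, 3]]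

theorem latinSquare_injective : ∀ i, Function.Injective fun j ↦ latinSquare i j := by
  decide

theorem latinSquare_injective_left : ∀ j, Function.Injective fun i ↦ latinSquare i j := by
  decide

theorem latinSquare_ne_left : ∀ {i j}, i ≠ j → latinSquare i j ≠ i := by
  decide

theorem latinSquare_ne_right : ∀ {i j}, i ≠ j → latinSquare i j ≠ j := by
  decide

theorem latinSquare_ne_swap : ∀ {i j}, i ≠ j → latinSquare i j ≠ latinSquare j i := by
  decide

theorem eq_latinSquare_or_eq_latinSquare_swap :
    ∀ {i j k}, i ≠ j → k ≠ i → k ≠ j → k = latinSquare i j ∨ k = latinSquare j i := by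
  decide

theorem exists_ne_ne_ne : ∀ i j k : Fin 4, ∃ l, l ≠ i ∧ l ≠ j ∧ l ≠ k := by
  decide

theorem eq_latinSquare_of_derangement :
    ∀ {i j l s}, [i, j, l, s].Nodup → ∀ {q r}, [i, latinSquare i j, q, r].Nodup →
      q ≠ l → r ≠ s → q = latinSquare i l := by
  decide

end LatinSquare

section Bipartition

variable {V : Type*} {G : SimpleGraph V} {C : G.EdgeLabeling (Fin 4)} {c : V → Fin 4}

namespace IsMissingColour

theorem get_eq_latinSquare (hc : IsMissingColour C c) (hC : IsStarEdgeColouring C) {u v w : V}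
    (huv : G.Adj u v) (huw : G.Adj u w) (h : C.get u v huv = latinSquare (c u) (c v)) :
    C.get u w huw = latinSquare (c u) (c w) := by
  obtain rfl | hvw := eq_or_ne v w
  · exact h
  obtain ⟨r, hru, hrv, hrw⟩ := exists_ne_ne_ne (c u) (C.get u v huv) (C.get u w huw)
  obtain ⟨x, hux, rfl⟩ := (hc u r).1 hru
  have hxv : x ≠ v := by rintro rfl; exact hrv rfl
  have hxw : x ≠ w := by rintro rfl; exact hrw rfl
  have hne {y : V} (huy : G.Adj u y) : c u ≠ c y := hc.ne_of_adj hC (by simp) huy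
  have hinj := hc.injOn_neighborSet hC u
  have hvw_get : C.get u v huv ≠ C.get u w huw := fun heq ↦ hvw (hC.proper.eq_of_get_eq huv huw heq)
  have hvertices : [c u, c v, c w, c x].Nodup := by
    simp [hne huv, hne huw, hne hux, hinj.ne huv huw hvw, hinj.ne huv hux hxv.symm,
      hinj.ne huw hux hxw.symm]
  have hedges : [c u, C.get u v huv, C.get u w huw, C.get u x hux].Nodup := by
    simp [(hc.get_ne_left _).symm, hvw_get, hrv.symm, hrw.symm]
  exact eq_latinSquare_of_derangement hvertices (h ▸ hedges) (hc.get_ne_right huw)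
    (hc.get_ne_right hux)

theorem isBipartite (hc : IsMissingColour C c) (hC : IsStarEdgeColouring C) : G.IsBipartite := by
  let followsRow (u : V) : Prop := ∃ v, ∃ huv : G.Adj u v, C.get u v huv = latinSquare (c u) (c v)
  have followsRow_iff {u v : V} (huv : G.Adj u v) :
      followsRow u ↔ C.get u v huv = latinSquare (c u) (c v) :=
    ⟨fun ⟨_, huw, h⟩ ↦ hc.get_eq_latinSquare hC huw huv h, fun h ↦ ⟨v, huv, h⟩⟩
  have followsRow_ne {u v : V} (huv : G.Adj u v) : followsRow u ≠ followsRow v := by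
    have hne : c u ≠ c v := hc.ne_of_adj hC (by simp) huv
    rw [Ne, eq_iff_iff, followsRow_iff huv, followsRow_iff huv.symm, C.get_comm u v]
    rcases eq_latinSquare_or_eq_latinSquare_swap hne (hc.get_ne_left huv)
      (hc.get_ne_right huv) with h | h
    · simp [h, latinSquare_ne_swap hne]
    · simp [h, latinSquare_ne_swap hne.symm]
  exact (SimpleGraph.Coloring.mk followsRow followsRow_ne).colorable

end IsMissingColour

end Bipartition

section Construction

variable {V α : Type*} {G : SimpleGraph V}

theorem IsProperEdgeColouring.isStarEdgeColouring_of_injOn [Fintype α] {C : G.EdgeLabeling α}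
    (hC : IsProperEdgeColouring C) (hcard : Fintype.card α ≤ 4) (c : G.Coloring α)
    (hinj : ∀ v, Set.InjOn c (G.neighborSet v))
    (hne : ∀ {u v : V} (huv : G.Adj u v), C.get u v huv ≠ c u) : IsStarEdgeColouring C := by
  classical
  have hne' {u v : V} (huv : G.Adj u v) : C.get u v huv ≠ c v :=
    C.get_comm v u huv ▸ hne huv.symm
  refine ⟨hC, fun z x u v y hzx hxu huv hvy hxv hcol hcol' ↦ ?_⟩
  have hxu_ne : C.get x u hxu ≠ C.get u v huv := fun h ↦
    hxv (hC.eq_of_get_eq hxu.symm huv ((C.get_comm _ _ _).trans h))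
  have hnodup : [C.get x u hxu, C.get u v huv, c x, c u, c v].Nodup := by
    have hcuv : c u ≠ c v := c.valid huv
    have hcxu : c x ≠ c u := c.valid hxu
    have hcxv : c x ≠ c v := (hinj u).ne hxu.symm huv hxv
    have h₁ : C.get u v huv ≠ c x := hcol ▸ hne' hzx
    have h₂ : C.get x u hxu ≠ c v := hcol' ▸ hne hvy
    simp [hxu_ne, hne, hne', hcuv, hcxu, hcxv, h₁, h₂]
  have := hnodup.length_le_card
  simp only [List.length_cons, List.length_nil] at this
  omega

/-- The edge colouring that reads the colour of the edge `xy` off the Latin square, at the position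
given by the colours of `x` and `y` under `c`. The row is taken from the endpoint in the part
`s = true` of the bipartition `s`, and the column from the other one. -/
def latinLabeling (s : G.Coloring Bool) (c : G.Coloring (Fin 4)) : G.EdgeLabeling (Fin 4) :=
  .mk (fun x y _ ↦ if s x then latinSquare (c x) (c y) else latinSquare (c y) (c x)) <| by
    intro x y hxy
    have hs : s x ≠ s y := s.valid hxy
    cases hx : s x <;> cases hy : s y <;> simp_all

theorem get_latinLabeling (s : G.Coloring Bool) (c : G.Coloring (Fin 4)) {x y : V}
    (hxy : G.Adj x y) : (latinLabeling s c).get x y hxy =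
      if s x then latinSquare (c x) (c y) else latinSquare (c y) (c x) :=
  rfl

theorem isProperEdgeColouring_latinLabeling (s : G.Coloring Bool) {c : G.Coloring (Fin 4)}
    (hinj : ∀ v, Set.InjOn c (G.neighborSet v)) :
    IsProperEdgeColouring (latinLabeling s c) := by
  rintro v ⟨x, (hx : G.Adj v x)⟩ ⟨y, (hy : G.Adj v y)⟩
    (hxy : (latinLabeling s c).get v x hx = (latinLabeling s c).get v y hy)
  refine Subtype.ext (hinj v hx hy ?_)
  rw [get_latinLabeling, get_latinLabeling] at hxy
  split at hxy
  · exact latinSquare_injective _ hxy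
  · exact latinSquare_injective_left _ hxy

theorem get_latinLabeling_ne (s : G.Coloring Bool) (c : G.Coloring (Fin 4)) {x y : V}
    (hxy : G.Adj x y) : (latinLabeling s c).get x y hxy ≠ c x := by
  rw [get_latinLabeling]
  split
  · exact latinSquare_ne_left (c.valid hxy)
  · exact latinSquare_ne_right (c.valid hxy.symm)

theorem isStarEdgeColouring_latinLabeling (s : G.Coloring Bool) {c : G.Coloring (Fin 4)}
    (hinj : ∀ v, Set.InjOn c (G.neighborSet v)) : IsStarEdgeColouring (latinLabeling s c) :=
  (isProperEdgeColouring_latinLabeling s hinj).isStarEdgeColouring_of_injOn (by simp) c hinj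
    (get_latinLabeling_ne s c)

end Construction

theorem mainTheorem3_general {V : Type*} (G : SimpleGraph V) [G.LocallyFinite]
    (hG : G.IsRegularOfDegree 3) :
    StarColourable G.lineGraph 4 ↔ G.IsBipartite ∧ DistanceTwoColourable G 4 := by
  rw [starColourable_lineGraph_iff fun v ↦ (G.neighborSet v).toFinite]
  constructor
  · rintro ⟨C, hC⟩
    obtain ⟨c, hc⟩ := exists_isMissingColour hG (Fintype.card_fin 4) hC.proper
    let f : G.Coloring (Fin 4) := .mk c (hc.ne_of_adj hC (Fintype.card_fin 4).ge)
    exact ⟨hc.isBipartite hC, f, (isDistanceTwoColouring_iff f).2 (hc.injOn_neighborSet hC)⟩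
  · rintro ⟨hbip, f, hf⟩
    let s : G.Coloring Bool := hbip.toColoring Fintype.card_bool.ge
    have hinj := (isDistanceTwoColouring_iff f).1 hf
    exact ⟨latinLabeling s f, isStarEdgeColouring_latinLabeling s hinj⟩

theorem mainTheorem3 {V : Type*} [Fintype V] (G : SimpleGraph V) [G.LocallyFinite]
    (hG : G.IsRegularOfDegree 3) :
    StarColourable G.lineGraph 4 ↔ G.IsBipartite ∧ DistanceTwoColourable G 4 :=
  mainTheorem3_general G hG
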